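/- **Proposition (Effective parallel width under correlated search information).** Let $K$ be a number of paths, let $\sigma_u>0$ and $\sigma_c\ge 0$, and let $Y\sim\mathcal N(0,1)$, $U\sim\mathcal N(0,\sigma_c^2)$ and $V_1,\dots,V_K\sim\mathcal N(0,\sigma_u^2)$ be real random variables such that $U,V_1,\dots,V_K$ are mutually independent and $(U,V_1,\dots,V_K)$ is independent of $Y$. Put $Z_i=Y+U+V_i$ for $i=1,\dots,K$ and $Z_{1:K}=(Z_1,\dots,Z_K)$. Let $I(Y;Z_{1:K})\in[0,\infty]$ denote the mutual information (in nats), i.e. the Kullback--Leibler divergence of the joint law of $(Y,Z_{1:K})$ from the product of the laws of $Y$ and $Z_{1:K}$. Then \[ I(Y;Z_{1:K})=\frac12\log\left(1+\frac{K}{\sigma_u^2+K\sigma_c^2}\right). \] Equivalently, \[ I(Y;Z_{1:K})=\frac12\log\left(1+\frac{K_{\mathrm{eff}}}{\sigma^2}\right), \qquad \sigma^2:=\sigma_u^2+\sigma_c^2,\quad \rho:=\frac{\sigma_c^2}{\sigma_u^2+\sigma_c^2},\quad K_{\mathrm{eff}}:=\frac{K}{1+(K-1)\rho}. \] In the degenerate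 case $\sigma_u=0$ (with the other assumptions unchanged) both formulas hold by continuity: $I(Y;Z_{1:K})$ is the limit, in $[0,\infty]$, of each of the two right-hand sides as $\sigma_u\downarrow 0$ with $K$ and $\sigma_c$ fixed. -/

import Mathlib

open MeasureTheory ProbabilityTheory Filter Topology
open scoped NNReal ENNReal

namespace GaussianRedundancy

/-- Mutual information (in nats, with values in `[0, ∞]`) of two random variables: the
Kullback-Leibler divergence of their joint law from the product of their laws. -/
noncomputable def mutualInfo {Ω E F : Type*} [MeasurableSpace Ω] [MeasurableSpace E]
    [MeasurableSpace F] (P : Measure Ω) (X : Ω → E) (Z : Ω → F) : ℝ≥0∞ :=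
  InformationTheory.klDiv (P.map (fun ω => (X ω, Z ω))) ((P.map X).prod (P.map Z))

/-- The random variables of the model: a standard Gaussian signal `Y`, a common noise `U` of
variance `σc ^ 2` and path noises `V i` of variance `σu ^ 2`; the noises `U, V 1, …, V K` are
mutually independent, and the family of the noises is independent of `Y`. -/
structure IsModel {Ω : Type*} [MeasurableSpace Ω] (P : Measure Ω) {K : ℕ} (σu σc : ℝ≥0)
    (Y U : Ω → ℝ) (V : Fin K → Ω → ℝ) : Prop where
  law_Y : HasLaw Y (gaussianReal 0 1) P
  law_U : HasLaw U (gaussianReal 0 (σc ^ 2)) P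
  law_V : ∀ i, HasLaw (V i) (gaussianReal 0 (σu ^ 2)) P
  indep_noise : iIndepFun (fun o : Option (Fin K) => o.elim U V) P
  indep_signal : IndepFun Y (fun ω => (U ω, fun i => V i ω)) P

/-- The observations `Z i = Y + U + V i` of all paths, as one random vector. -/
def observations {Ω : Type*} {K : ℕ} (Y U : Ω → ℝ) (V : Fin K → Ω → ℝ) : Ω → Fin K → ℝ :=
  fun ω i => Y ω + U ω + V i ω

/-- Marginal noise variance `σ² = σu² + σc²`. -/
def noiseVar (σu σc : ℝ) : ℝ := σu ^ 2 + σc ^ 2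

/-- Pairwise noise correlation `ρ = σc² / (σu² + σc²)`. -/
noncomputable def noiseCorr (σu σc : ℝ) : ℝ := σc ^ 2 / (σu ^ 2 + σc ^ 2)

/-- Effective width `K / (1 + (K - 1) ρ)`. -/
noncomputable def effWidth (K : ℕ) (σu σc : ℝ) : ℝ :=
  (K : ℝ) / (1 + ((K : ℝ) - 1) * noiseCorr σu σc)

end GaussianRedundancy

namespace GaussianRedundancy

-- Averaging the observations loses nothing. The average is `Y` plus `meanNoise`, and each
-- observation is recovered from it by adding a component of `deviation`. The noises are jointly
-- Gaussian and `meanNoise` is uncorrelated with every deviation, so the deviations are independent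
-- of `(Y, meanNoise)` and carry no information. By `mutualInfo_eq_of_sufficient` the problem
-- becomes a scalar channel with noise variance `σc² + σu² / K`, and `mutualInfo_gaussian_channel`
-- gives its information by integrating the explicit log-likelihood ratio. At `σu = 0` the same
-- formula applies if `σc ≠ 0`, and the limit is continuity at zero. If both vanish and `K ≠ 0`, the
-- average equals `Y` almost surely, and information and limit are both infinite.

-- Sufficient statistics and mutual information

lemma klDiv_prod_right {E F : Type*} [MeasurableSpace E] [MeasurableSpace F]
    (μ ν : Measure E) [IsFiniteMeasure μ] [IsFiniteMeasure ν] (κ : Measure F)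
    [IsProbabilityMeasure κ] :
    InformationTheory.klDiv (μ.prod κ) (ν.prod κ) = InformationTheory.klDiv μ ν := by
  rw [← Measure.compProd_const, ← Measure.compProd_const,
    InformationTheory.klDiv_compProd_left]

lemma indepFun_prodMk_left {Ω E F G : Type*} [MeasurableSpace Ω] [MeasurableSpace E]
    [MeasurableSpace F] [MeasurableSpace G] {P : Measure Ω} [IsProbabilityMeasure P]
    {X : Ω → E} {T : Ω → F} {R : Ω → G} (hX : AEMeasurable X P) (hT : AEMeasurable T P)
    (hR : AEMeasurable R P) (hXTR : IndepFun X (fun ω => (T ω, R ω)) P) (hTR : IndepFun T R P) :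
    IndepFun (fun ω => (X ω, T ω)) R P := by
  have := Measure.isProbabilityMeasure_map (μ := P) hX
  have := Measure.isProbabilityMeasure_map (μ := P) hT
  have := Measure.isProbabilityMeasure_map (μ := P) hR
  have hXT : IndepFun X T P := hXTR.comp measurable_id measurable_fst
  rw [indepFun_iff_map_prod_eq_prod_map_map hX (hT.prodMk hR)] at hXTR
  rw [indepFun_iff_map_prod_eq_prod_map_map hT hR] at hTR
  rw [indepFun_iff_map_prod_eq_prod_map_map hX hT] at hXT
  rw [indepFun_iff_map_prod_eq_prod_map_map (hX.prodMk hT) hR, hXT]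
  rw [hTR, ← Measure.prodAssoc_prod] at hXTR
  have h := congrArg (Measure.map MeasurableEquiv.prodAssoc.symm) hXTR
  rw [MeasurableEquiv.map_symm_map, AEMeasurable.map_map_of_aemeasurable
    (by fun_prop) (by fun_prop)] at h
  exact h

/-- If `Z` is a function of `(S, R)` with `R` independent of `(X, S)`, and `S` is a function of
`Z`, then `S` is sufficient: it carries all the information of `Z` about `X`. -/
lemma mutualInfo_eq_of_sufficient {Ω E F G H : Type*} [MeasurableSpace Ω] [MeasurableSpace E]
    [MeasurableSpace F] [MeasurableSpace G] [MeasurableSpace H] {P : Measure Ω}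
    [IsProbabilityMeasure P] {X : Ω → E} {S : Ω → F} {R : Ω → G} {Z : Ω → H}
    (hX : AEMeasurable X P) (hS : AEMeasurable S P) (hR : AEMeasurable R P)
    (hind : IndepFun (fun ω => (X ω, S ω)) R P) {f : H → F} {g : F × G → H}
    (hf : Measurable f) (hg : Measurable g) (hSf : ∀ ω, S ω = f (Z ω))
    (hZg : ∀ ω, Z ω = g (S ω, R ω)) :
    mutualInfo P X Z = mutualInfo P X S := by
  have := Measure.isProbabilityMeasure_map (μ := P) hX
  have := Measure.isProbabilityMeasure_map (μ := P) hS
  have := Measure.isProbabilityMeasure_map (μ := P) hR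
  have := Measure.isProbabilityMeasure_map (μ := P) (hX.prodMk hS)
  obtain rfl : Z = fun ω => g (S ω, R ω) := funext hZg
  have hZ : AEMeasurable (fun ω => g (S ω, R ω)) P := hg.comp_aemeasurable (hS.prodMk hR)
  have := Measure.isProbabilityMeasure_map (μ := P) hZ
  have := Measure.isProbabilityMeasure_map (μ := P) (hX.prodMk hZ)
  have hSR : IndepFun S R P := hind.comp measurable_snd measurable_id
  rw [indepFun_iff_map_prod_eq_prod_map_map (hX.prodMk hS) hR] at hind
  rw [indepFun_iff_map_prod_eq_prod_map_map hS hR] at hSR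
  unfold mutualInfo
  -- Data processing in both directions: `(X, Z)` is an image of `((X, S), R)`, where the
  -- independent factor `R` adds no divergence, and `(X, S)` is an image of `(X, Z)`.
  apply le_antisymm
  · have hk : Measurable (fun p : (E × F) × G => (p.1.1, g (p.1.2, p.2))) := by fun_prop
    have h₁ : P.map (fun ω => (X ω, g (S ω, R ω))) =
        ((P.map (fun ω => (X ω, S ω))).prod (P.map R)).map
          (fun p : (E × F) × G => (p.1.1, g (p.1.2, p.2))) := by
      rw [← hind, AEMeasurable.map_map_of_aemeasurable hk.aemeasurable
        ((hX.prodMk hS).prodMk hR)]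
      rfl
    have h₂ : (P.map X).prod (P.map (fun ω => g (S ω, R ω))) =
        (((P.map X).prod (P.map S)).prod (P.map R)).map
          (fun p : (E × F) × G => (p.1.1, g (p.1.2, p.2))) := by
      have h₃ : P.map (fun ω => g (S ω, R ω)) = ((P.map S).prod (P.map R)).map g := by
        rw [← hSR, AEMeasurable.map_map_of_aemeasurable hg.aemeasurable (hS.prodMk hR)]
        rfl
      have h₄ : (P.map X).prod (((P.map S).prod (P.map R)).map g) =
          ((P.map X).map id).prod (((P.map S).prod (P.map R)).map g) := by rw [Measure.map_id]
      rw [h₃, h₄, Measure.map_prod_map _ _ measurable_id hg, ← Measure.prodAssoc_prod,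
        Measure.map_map (measurable_id.prodMap hg) MeasurableEquiv.prodAssoc.measurable]
      rfl
    rw [h₁, h₂]
    exact (InformationTheory.klDiv_map_le _ _ hk).trans (klDiv_prod_right _ _ _).le
  · have hk : Measurable (Prod.map id f : E × H → E × F) := measurable_id.prodMap hf
    have h₁ : P.map (fun ω => (X ω, S ω)) =
        (P.map (fun ω => (X ω, g (S ω, R ω)))).map (Prod.map id f) := by
      rw [AEMeasurable.map_map_of_aemeasurable hk.aemeasurable (hX.prodMk hZ)]
      congr 1
      ext ω
      · rfl
      · exact hSf ω
    have h₂ : (P.map X).prod (P.map S) =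
        ((P.map X).prod (P.map (fun ω => g (S ω, R ω)))).map (Prod.map id f) := by
      rw [← Measure.map_prod_map _ _ measurable_id hf, Measure.map_id,
        AEMeasurable.map_map_of_aemeasurable hf.aemeasurable hZ]
      congr 2
      ext ω
      exact hSf ω
    rw [h₁, h₂]
    exact InformationTheory.klDiv_map_le _ _ hk

-- The scalar Gaussian channel

lemma gaussianReal_withDensity_div {m₁ m₂ : ℝ} {v₁ v₂ : ℝ≥0} (h₁ : v₁ ≠ 0) (h₂ : v₂ ≠ 0) :
    (gaussianReal m₁ v₁).withDensity (fun s => gaussianPDF m₂ v₂ s / gaussianPDF m₁ v₁ s) =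
      gaussianReal m₂ v₂ := by
  rw [gaussianReal_of_var_ne_zero _ h₁, gaussianReal_of_var_ne_zero _ h₂,
    ← withDensity_mul _ (by fun_prop) (by fun_prop)]
  congr 1
  ext s
  exact ENNReal.mul_div_cancel (gaussianPDF_pos m₁ h₁ s).ne' gaussianPDF_ne_top

/-- Over a fixed first coordinate `y`, the sum is Gaussian with mean `y`; the density is the
fibrewise ratio of the two Gaussian densities. -/
lemma map_prod_gaussianReal_add (μ : Measure ℝ) [IsProbabilityMeasure μ] {v w : ℝ≥0}
    (hv : v ≠ 0) (hw : w ≠ 0) :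
    (μ.prod (gaussianReal 0 v)).map (fun p => (p.1, p.1 + p.2)) =
      (μ.prod (gaussianReal 0 w)).withDensity
        (fun p => gaussianPDF p.1 v p.2 / gaussianPDF 0 w p.2) := by
  have hr : Measurable (fun p : ℝ × ℝ => gaussianPDF p.1 v p.2 / gaussianPDF 0 w p.2) := by
    have h1 : Measurable (fun p : ℝ × ℝ => gaussianPDF p.1 v p.2) :=
      measurable_uncurry_gaussianPDF.comp (by fun_prop : Measurable fun p : ℝ × ℝ => (p.1, v, p.2))
    have h2 : Measurable (fun p : ℝ × ℝ => gaussianPDF 0 w p.2) := by fun_prop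
    exact h1.div h2
  ext A hA
  have hk : Measurable (fun p : ℝ × ℝ => (p.1, p.1 + p.2)) := by fun_prop
  rw [Measure.map_apply hk hA, Measure.prod_apply (hk hA), withDensity_apply _ hA,
    ← lintegral_indicator hA, lintegral_prod _ (hr.indicator hA).aemeasurable]
  refine lintegral_congr fun y => ?_
  have hy : MeasurableSet (Prod.mk y ⁻¹' A) := measurable_prodMk_left hA
  have h1 : gaussianReal 0 v (Prod.mk y ⁻¹' ((fun p : ℝ × ℝ => (p.1, p.1 + p.2)) ⁻¹' A)) =
      gaussianReal y v (Prod.mk y ⁻¹' A) := by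
    have h := gaussianReal_map_const_add (μ := 0) (v := v) y
    rw [zero_add] at h
    rw [← h, Measure.map_apply (by fun_prop) hy]
    rfl
  rw [h1, ← gaussianReal_withDensity_div hw hv, withDensity_apply _ hy,
    ← lintegral_indicator hy]
  rfl

lemma log_toReal_gaussianPDF_div {v w : ℝ≥0} (hv : v ≠ 0) (hw : w ≠ 0) (m₁ m₂ s : ℝ) :
    Real.log (gaussianPDF m₁ v s / gaussianPDF m₂ w s).toReal =
      1 / 2 * Real.log (w / v) - (s - m₁) ^ 2 / (2 * v) + (s - m₂) ^ 2 / (2 * w) := by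
  have hv' : (0 : ℝ) < v := by positivity
  have hw' : (0 : ℝ) < w := by positivity
  rw [ENNReal.toReal_div, toReal_gaussianPDF, toReal_gaussianPDF,
    Real.log_div (gaussianPDFReal_pos _ _ _ hv).ne' (gaussianPDFReal_pos _ _ _ hw).ne']
  have key (m : ℝ) {u : ℝ≥0} (hu : (0 : ℝ) < u) : Real.log (gaussianPDFReal m u s) =
      -(1 / 2 * (Real.log (2 * Real.pi) + Real.log u)) - (s - m) ^ 2 / (2 * u) := by
    rw [gaussianPDFReal, Real.log_mul (by positivity) (by positivity), Real.log_exp, Real.log_inv,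
      Real.log_sqrt (by positivity), Real.log_mul (by positivity) hu.ne']
    ring
  rw [key m₁ hv', key m₂ hw', Real.log_div hw'.ne' hv'.ne']
  ring

lemma integral_sq_of_hasLaw_gaussianReal {Ω : Type*} [MeasurableSpace Ω] {P : Measure Ω}
    {X : Ω → ℝ} {v : ℝ≥0} (hX : HasLaw X (gaussianReal 0 v) P) : ∫ ω, X ω ^ 2 ∂P = v := by
  have h0 : ∫ ω, X ω ∂P = 0 := by rw [hX.integral_eq, integral_id_gaussianReal]
  rw [← variance_of_integral_eq_zero hX.aemeasurable h0, hX.variance_eq]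
  exact variance_id_gaussianReal

/-- The log-likelihood ratio is the constant `1 / 2 * log ((1 + v) / v)` plus two quadratic terms
with means `-1/2` and `1/2`, which cancel. -/
lemma mutualInfo_gaussian_channel {Ω : Type*} [MeasurableSpace Ω] {P : Measure Ω}
    [IsProbabilityMeasure P] {X W : Ω → ℝ} {v : ℝ≥0} (hv : v ≠ 0)
    (hX : HasLaw X (gaussianReal 0 1) P) (hW : HasLaw W (gaussianReal 0 v) P)
    (hXW : IndepFun X W P) :
    mutualInfo P X (fun ω => X ω + W ω) =
      ENNReal.ofReal (1 / 2 * Real.log (1 + 1 / (v : ℝ))) := by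
  have hXm := hX.aemeasurable
  have hWm := hW.aemeasurable
  have hw : 1 + v ≠ 0 := by positivity
  have hv' : (0 : ℝ) < v := by positivity
  have hS : HasLaw (fun ω => X ω + W ω) (gaussianReal 0 (1 + v)) P := by
    refine ⟨by fun_prop, ?_⟩
    have h := gaussianReal_add_gaussianReal_of_indepFun hXW hX.map_eq hW.map_eq
    rwa [add_zero] at h
  have hjoint : P.map (fun ω => (X ω, X ω + W ω)) =
      ((gaussianReal 0 1).prod (gaussianReal 0 (1 + v))).withDensity
        (fun p => gaussianPDF p.1 v p.2 / gaussianPDF 0 (1 + v) p.2) := by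
    rw [← map_prod_gaussianReal_add _ hv hw, ← hX.map_eq, ← hW.map_eq,
      ← (indepFun_iff_map_prod_eq_prod_map_map hXm hWm).1 hXW,
      AEMeasurable.map_map_of_aemeasurable (by fun_prop) (by fun_prop)]
    rfl
  have hr : Measurable (fun p : ℝ × ℝ => gaussianPDF p.1 v p.2 / gaussianPDF 0 (1 + v) p.2) := by
    have h1 : Measurable (fun p : ℝ × ℝ => gaussianPDF p.1 v p.2) :=
      measurable_uncurry_gaussianPDF.comp (by fun_prop : Measurable fun p : ℝ × ℝ => (p.1, v, p.2))
    have h2 : Measurable (fun p : ℝ × ℝ => gaussianPDF 0 (1 + v) p.2) := by fun_prop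
    exact h1.div h2
  have hac : P.map (fun ω => (X ω, X ω + W ω)) ≪
      (gaussianReal 0 1).prod (gaussianReal 0 (1 + v)) := by
    rw [hjoint]
    exact withDensity_absolutelyContinuous _ _
  have hllr : llr (P.map (fun ω => (X ω, X ω + W ω)))
      ((gaussianReal 0 1).prod (gaussianReal 0 (1 + v))) =ᵐ[P.map (fun ω => (X ω, X ω + W ω))]
      fun p => 1 / 2 * Real.log (((1 + v : ℝ≥0) : ℝ) / v) - (p.2 - p.1) ^ 2 / (2 * v) +
        (p.2 - 0) ^ 2 / (2 * ((1 + v : ℝ≥0) : ℝ)) := by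
    have h := Measure.rnDeriv_withDensity
      ((gaussianReal 0 1).prod (gaussianReal 0 (1 + v))) hr
    rw [← hjoint] at h
    filter_upwards [hac.ae_le h] with p hp
    rw [llr, hp, log_toReal_gaussianPDF_div hv hw]
  have hW2 : Integrable (fun ω => W ω ^ 2) P :=
    (hW.hasGaussianLaw.memLp_two).integrable_sq
  have hS2 : Integrable (fun ω => (X ω + W ω) ^ 2) P :=
    (hS.hasGaussianLaw.memLp_two).integrable_sq
  have hmeas : Measurable fun p : ℝ × ℝ =>
      1 / 2 * Real.log (((1 + v : ℝ≥0) : ℝ) / v) - (p.2 - p.1) ^ 2 / (2 * v) +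
        (p.2 - 0) ^ 2 / (2 * ((1 + v : ℝ≥0) : ℝ)) := by fun_prop
  have hpm : AEMeasurable (fun ω => (X ω, X ω + W ω)) P := by fun_prop
  have := Measure.isProbabilityMeasure_map (μ := P) hpm
  have hint : Integrable (fun ω => 1 / 2 * Real.log (((1 + v : ℝ≥0) : ℝ) / v) -
      W ω ^ 2 / (2 * v)) P := (integrable_const _).sub (hW2.div_const _)
  unfold mutualInfo
  rw [hX.map_eq, hS.map_eq, InformationTheory.klDiv_of_ac_of_integrable hac]
  · rw [integral_congr_ae hllr, integral_map hpm hmeas.aestronglyMeasurable]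
    simp only [add_sub_cancel_left, sub_zero, probReal_univ, add_sub_cancel_right]
    rw [integral_add hint (hS2.div_const _), integral_sub (integrable_const _) (hW2.div_const _),
      integral_div, integral_div, integral_sq_of_hasLaw_gaussianReal hW,
      integral_sq_of_hasLaw_gaussianReal hS]
    congr 1
    rw [integral_const, probReal_univ, one_smul, NNReal.coe_add, NNReal.coe_one]
    have : ((1 : ℝ) + v) / v = 1 + 1 / v := by field_simp; ring
    rw [this]
    field_simp
    ring
  · refine Integrable.congr ?_ hllr.symm
    rw [integrable_map_measure hmeas.aestronglyMeasurable hpm]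
    simp only [Function.comp_def, add_sub_cancel_left, sub_zero]
    exact hint.add (hS2.div_const _)

/-- The joint law lives on the diagonal, which is null for the product law because a nondegenerate
Gaussian has no atoms. -/
lemma mutualInfo_self_gaussian {Ω : Type*} [MeasurableSpace Ω] {P : Measure Ω}
    [IsProbabilityMeasure P] {X S : Ω → ℝ} (hX : HasLaw X (gaussianReal 0 1) P)
    (hS : S =ᵐ[P] X) : mutualInfo P X S = ∞ := by
  have hXm := hX.aemeasurable
  have := nullSingletonClass_gaussianReal (μ := 0) (v := 1) one_ne_zero
  unfold mutualInfo
  rw [Measure.map_congr hS,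
    Measure.map_congr (hS.mono fun ω h => by simp only [h] : (fun ω => (X ω, S ω)) =ᵐ[P]
      fun ω => (X ω, X ω))]
  refine InformationTheory.klDiv_of_not_ac fun hac => ?_
  have hd : MeasurableSet (Set.diagonal ℝ) := measurableSet_diagonal
  have h0 : ((P.map X).prod (P.map X)) (Set.diagonal ℝ) = 0 := by
    rw [Measure.prod_apply hd, hX.map_eq]
    have (y : ℝ) : Prod.mk y ⁻¹' Set.diagonal ℝ = {y} := by ext; simp [eq_comm]
    simp [this]
  have h1 := hac h0
  have hu : (fun ω => (X ω, X ω)) ⁻¹' Set.diagonal ℝ = Set.univ :=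
    Set.eq_univ_of_forall fun _ => rfl
  rw [Measure.map_apply_of_aemeasurable (by fun_prop) hd, hu, measure_univ] at h1
  exact one_ne_zero h1

-- Mean and deviations of the noise

lemma covariance_linearCombination_of_iIndepFun {Ω ι : Type*} [MeasurableSpace Ω] [Fintype ι]
    {P : Measure Ω} {N : ι → Ω → ℝ} (hN : ∀ i, MemLp (N i) 2 P) (hind : iIndepFun N P)
    (c d : ι → ℝ) :
    cov[fun ω => ∑ i, c i * N i ω, fun ω => ∑ i, d i * N i ω; P] =
      ∑ i, c i * d i * Var[N i; P] := by
  classical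
  have := hind.isProbabilityMeasure
  rw [covariance_fun_sum_fun_sum (fun i => (hN i).const_mul _) (fun i => (hN i).const_mul _)]
  refine Finset.sum_congr rfl fun i _ => ?_
  rw [Finset.sum_eq_single i]
  · rw [covariance_const_mul_left, covariance_const_mul_right,
      covariance_self (hN i).aemeasurable]
    ring
  · intro j _ hji
    rw [covariance_const_mul_left, covariance_const_mul_right,
      (hind.indepFun hji.symm).covariance_eq_zero (hN i) (hN j)]
    simp
  · simp

variable {Ω : Type*} [MeasurableSpace Ω] {P : Measure Ω} {K : ℕ} {σu σc : ℝ≥0} {Y U : Ω → ℝ}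
  {V : Fin K → Ω → ℝ}

/-- The noise `U + (V 1 + ⋯ + V K) / K` of the averaged observation. -/
noncomputable def meanNoise {Ω : Type*} {K : ℕ} (U : Ω → ℝ) (V : Fin K → Ω → ℝ) (ω : Ω) : ℝ :=
  U ω + (∑ j, V j ω) / K

/-- The deviations of the path noises from their mean. -/
noncomputable def deviation {Ω : Type*} {K : ℕ} (V : Fin K → Ω → ℝ) (ω : Ω) (i : Fin K) : ℝ :=
  V i ω - (∑ j, V j ω) / K

/-- Coefficients of `meanNoise` with respect to the noise family. -/
noncomputable def meanCoeff (K : ℕ) (o : Option (Fin K)) : ℝ := o.elim 1 (fun _ => (K : ℝ)⁻¹)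

/-- Coefficients of `deviation` with respect to the noise family. -/
noncomputable def deviationCoeff (K : ℕ) (i : Fin K) (o : Option (Fin K)) : ℝ :=
  o.elim 0 (fun j => (if j = i then 1 else 0) - (K : ℝ)⁻¹)

lemma meanNoise_eq_sum {Ω : Type*} {U : Ω → ℝ} {V : Fin K → Ω → ℝ} (ω : Ω) :
    meanNoise U V ω = ∑ o, meanCoeff K o * (o.elim U V : Ω → ℝ) ω := by
  simp only [meanNoise, meanCoeff, Fintype.sum_option, Option.elim]
  rw [← Finset.mul_sum]
  ring

lemma deviation_eq_sum {Ω : Type*} {U : Ω → ℝ} {V : Fin K → Ω → ℝ} (ω : Ω) (i : Fin K) :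
    deviation V ω i = ∑ o, deviationCoeff K i o * (o.elim U V : Ω → ℝ) ω := by
  simp only [deviation, deviationCoeff, Fintype.sum_option, Option.elim, sub_mul, ite_mul, one_mul,
    zero_mul, Finset.sum_sub_distrib, Finset.sum_ite_eq', Finset.mem_univ, if_true]
  rw [← Finset.mul_sum]
  ring

lemma IsModel.hasGaussianLaw_noise (h : IsModel P σu σc Y U V) (o : Option (Fin K)) :
    HasGaussianLaw (o.elim U V : Ω → ℝ) P := by
  cases o with
  | none => exact h.law_U.hasGaussianLaw
  | some i => exact (h.law_V i).hasGaussianLaw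

lemma IsModel.variance_U (h : IsModel P σu σc Y U V) : Var[U; P] = (σc : ℝ) ^ 2 := by
  rw [h.law_U.variance_eq, variance_id_gaussianReal, NNReal.coe_pow]

lemma IsModel.variance_V (h : IsModel P σu σc Y U V) (i : Fin K) :
    Var[V i; P] = (σu : ℝ) ^ 2 := by
  rw [(h.law_V i).variance_eq, variance_id_gaussianReal, NNReal.coe_pow]

lemma IsModel.hasGaussianLaw_meanNoise_deviation (h : IsModel P σu σc Y U V) :
    HasGaussianLaw (fun ω => (meanNoise U V ω, deviation V ω)) P := by
  have hN := iIndepFun.hasGaussianLaw h.hasGaussianLaw_noise h.indep_noise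
  let L : (Option (Fin K) → ℝ) →L[ℝ] ℝ × (Fin K → ℝ) :=
    (∑ o, meanCoeff K o • ContinuousLinearMap.proj (R := ℝ) (φ := fun _ => ℝ) o).prod
      (ContinuousLinearMap.pi fun i =>
        ∑ o, deviationCoeff K i o • ContinuousLinearMap.proj (R := ℝ) (φ := fun _ => ℝ) o)
  have hL : (fun ω => (meanNoise U V ω, deviation V ω)) =
      fun ω => L (fun o => (o.elim U V : Ω → ℝ) ω) := by
    ext ω i
    · simp [L, meanNoise_eq_sum]
    · simp [L, deviation_eq_sum (U := U)]
  rw [hL]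
  exact hN.map_fun L

lemma IsModel.indepFun_meanNoise_deviation (h : IsModel P σu σc Y U V) (hK : K ≠ 0) :
    IndepFun (meanNoise U V) (deviation V) P := by
  have hK' : (K : ℝ) ≠ 0 := by exact_mod_cast hK
  have hG := h.hasGaussianLaw_meanNoise_deviation
  -- The covariance criterion is for families, so the scalar mean is viewed as a family over `Unit`.
  let D : ℝ →L[ℝ] (Unit → ℝ) := ContinuousLinearMap.pi fun _ => ContinuousLinearMap.id ℝ ℝ
  have hG' : HasGaussianLaw (fun ω => ((fun _ : Unit => meanNoise U V ω),
      (fun i => deviation V ω i))) P :=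
    hG.map_fun (D.prodMap (ContinuousLinearMap.id ℝ (Fin K → ℝ)))
  have hind := hG'.indepFun_of_covariance_eval (X := fun _ : Unit => meanNoise U V)
    (Y := fun i ω => deviation V ω i) ?_
  · exact hind.comp (measurable_pi_apply ()) measurable_id
  · intro _ i
    have hT : meanNoise U V = fun ω => ∑ o, meanCoeff K o * (o.elim U V : Ω → ℝ) ω :=
      funext meanNoise_eq_sum
    have hR : (fun ω => deviation V ω i) =
        fun ω => ∑ o, deviationCoeff K i o * (o.elim U V : Ω → ℝ) ω :=
      funext fun ω => deviation_eq_sum ω i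
    rw [hT, hR, covariance_linearCombination_of_iIndepFun
      (fun o => (h.hasGaussianLaw_noise o).memLp_two) h.indep_noise]
    -- The common noise drops out, and the coefficients of a deviation sum to `1 - K * K⁻¹ = 0`.
    simp only [meanCoeff, deviationCoeff, Fintype.sum_option, Option.elim, h.variance_V]
    rw [← Finset.sum_mul, ← Finset.mul_sum]
    simp [hK']

lemma IsModel.law_meanNoise (h : IsModel P σu σc Y U V) (hK : K ≠ 0) :
    HasLaw (meanNoise U V) (gaussianReal 0 (σc ^ 2 + σu ^ 2 / K)) P := by
  have hK' : (K : ℝ) ≠ 0 := by exact_mod_cast hK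
  have hG : HasGaussianLaw (meanNoise U V) P := h.hasGaussianLaw_meanNoise_deviation.fst
  refine ⟨hG.aemeasurable, ?_⟩
  have hT : meanNoise U V = fun ω => ∑ o, meanCoeff K o * (o.elim U V : Ω → ℝ) ω :=
    funext meanNoise_eq_sum
  rw [hG.map_eq_gaussianReal]
  congr 1
  · rw [hT, integral_finsetSum _ fun o _ => (h.hasGaussianLaw_noise o).integrable.const_mul _]
    refine Finset.sum_eq_zero fun o _ => ?_
    rw [integral_const_mul]
    cases o with
    | none => simp [h.law_U.integral_eq]
    | some i => simp [(h.law_V i).integral_eq]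
  · have hvar : Var[meanNoise U V; P] = ((σc ^ 2 + σu ^ 2 / K : ℝ≥0) : ℝ) := by
      rw [← covariance_self hG.aemeasurable, hT, covariance_linearCombination_of_iIndepFun
        (fun o => (h.hasGaussianLaw_noise o).memLp_two) h.indep_noise]
      simp only [meanCoeff, Fintype.sum_option, Option.elim, h.variance_V, h.variance_U]
      simp
      field_simp
    rw [hvar, Real.toNNReal_coe]

lemma IsModel.indepFun_signal_meanNoise_deviation (h : IsModel P σu σc Y U V) :
    IndepFun Y (fun ω => (meanNoise U V ω, deviation V ω)) P := by
  let φ : ℝ × (Fin K → ℝ) → ℝ × (Fin K → ℝ) :=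
    fun p => (p.1 + (∑ j, p.2 j) / K, fun i => p.2 i - (∑ j, p.2 j) / K)
  have hφ : Measurable φ := by fun_prop
  exact h.indep_signal.comp measurable_id hφ

/-- The average of the observations is sufficient for the signal. -/
lemma IsModel.mutualInfo_observations_eq [IsProbabilityMeasure P] (h : IsModel P σu σc Y U V)
    (hK : K ≠ 0) :
    mutualInfo P Y (observations Y U V) = mutualInfo P Y (fun ω => Y ω + meanNoise U V ω) := by
  have hK' : (K : ℝ) ≠ 0 := by exact_mod_cast hK
  have hY := h.law_Y.aemeasurable
  have hT : AEMeasurable (meanNoise U V) P := (h.law_meanNoise hK).aemeasurable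
  have hR : AEMeasurable (deviation V) P :=
    h.hasGaussianLaw_meanNoise_deviation.aemeasurable.snd
  have hind := indepFun_prodMk_left hY hT hR h.indepFun_signal_meanNoise_deviation
    (h.indepFun_meanNoise_deviation hK)
  have hind' : IndepFun (fun ω => (Y ω, Y ω + meanNoise U V ω)) (deviation V) P :=
    hind.comp (φ := fun p : ℝ × ℝ => (p.1, p.1 + p.2)) (by fun_prop) measurable_id
  refine mutualInfo_eq_of_sufficient hY (hY.add hT) hR hind'
    (f := fun z : Fin K → ℝ => (∑ i, z i) / K)
    (g := fun p : ℝ × (Fin K → ℝ) => fun i => p.1 + p.2 i) (by fun_prop) (by fun_prop) ?_ ?_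
  · intro ω
    simp only [meanNoise, observations, Finset.sum_add_distrib, Finset.sum_const, Finset.card_univ,
      Fintype.card_fin, nsmul_eq_mul]
    field_simp
    ring
  · intro ω
    ext i
    simp only [meanNoise, observations, deviation]
    ring

-- The formula and its degenerate limit

lemma mutualInfo_of_subsingleton {E F : Type*} [MeasurableSpace E] [MeasurableSpace F]
    [Subsingleton F] [IsProbabilityMeasure P] {X : Ω → E} (hX : AEMeasurable X P) (Z : Ω → F) :
    mutualInfo P X Z = 0 := by
  have hZ : AEMeasurable Z P := (measurable_of_subsingleton_codomain Z).aemeasurable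
  have := Measure.isProbabilityMeasure_map (μ := P) hX
  have := Measure.isProbabilityMeasure_map (μ := P) hZ
  obtain ⟨ω₀⟩ : Nonempty Ω := P.nonempty_of_neZero
  have hc : Z = fun _ => Z ω₀ := funext fun ω => Subsingleton.elim _ _
  have hind : IndepFun X Z P := by
    rw [hc]
    exact indepFun_const_right X (Z ω₀)
  unfold mutualInfo
  rw [(indepFun_iff_map_prod_eq_prod_map_map hX hZ).1 hind, InformationTheory.klDiv_self]

/-- The disjunction excludes only the noiseless case with at least one path, so the degenerate limit
can also use this formula. -/
lemma IsModel.mutualInfo_eq [IsProbabilityMeasure P] (h : IsModel P σu σc Y U V)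
    (hv : K = 0 ∨ σu ≠ 0 ∨ σc ≠ 0) :
    mutualInfo P Y (observations Y U V) =
      ENNReal.ofReal
        (1 / 2 * Real.log (1 + (K : ℝ) / ((σu : ℝ) ^ 2 + (K : ℝ) * (σc : ℝ) ^ 2))) := by
  rcases eq_or_ne K 0 with rfl | hK
  · rw [mutualInfo_of_subsingleton h.law_Y.aemeasurable]
    simp
  have hv' : σc ^ 2 + σu ^ 2 / (K : ℝ≥0) ≠ 0 := by
    have : (K : ℝ≥0) ≠ 0 := by exact_mod_cast hK
    intro h0
    rw [add_eq_zero, div_eq_zero_iff] at h0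
    simp_all
  have hind : IndepFun Y (meanNoise U V) P :=
    h.indepFun_signal_meanNoise_deviation.comp measurable_id measurable_fst
  rw [h.mutualInfo_observations_eq hK,
    mutualInfo_gaussian_channel hv' h.law_Y (h.law_meanNoise hK) hind]
  congr 4
  have hK' : (K : ℝ) ≠ 0 := by exact_mod_cast hK
  push_cast
  have : (σc : ℝ) ^ 2 + (σu : ℝ) ^ 2 / K = ((σu : ℝ) ^ 2 + K * (σc : ℝ) ^ 2) / K := by
    field_simp
    ring
  rw [this, one_div_div]

lemma IsModel.mutualInfo_eq_top [IsProbabilityMeasure P] (h : IsModel P 0 0 Y U V)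
    (hK : K ≠ 0) : mutualInfo P Y (observations Y U V) = ∞ := by
  rw [h.mutualInfo_observations_eq hK]
  refine mutualInfo_self_gaussian h.law_Y ?_
  have hT := h.law_meanNoise hK
  have h0 : ∀ᵐ t ∂(P.map (meanNoise U V)), t = 0 := by
    rw [hT.map_eq]
    simp [ae_dirac_eq]
  filter_upwards [ae_of_ae_map hT.aemeasurable h0] with ω hω
  rw [hω, add_zero]

lemma effWidth_div_noiseVar (K : ℕ) {s : ℝ} (hs : 0 < s) (c : ℝ) :
    effWidth K s c / noiseVar s c = (K : ℝ) / (s ^ 2 + K * c ^ 2) := by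
  have h1 : 0 < s ^ 2 + c ^ 2 := by positivity
  have h2 : 0 < s ^ 2 + K * c ^ 2 := by positivity
  have h3 : 1 + ((K : ℝ) - 1) * (c ^ 2 / (s ^ 2 + c ^ 2)) =
      (s ^ 2 + K * c ^ 2) / (s ^ 2 + c ^ 2) := by
    field_simp
    ring
  rw [effWidth, noiseVar, noiseCorr, h3]
  field_simp

lemma IsModel.tendsto_mutualInfo [IsProbabilityMeasure P] (h : IsModel P 0 σc Y U V) :
    Tendsto (fun s : ℝ => ENNReal.ofReal
        (1 / 2 * Real.log (1 + (K : ℝ) / (s ^ 2 + (K : ℝ) * (σc : ℝ) ^ 2))))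
      (𝓝[>] 0) (𝓝 (mutualInfo P Y (observations Y U V))) := by
  rcases eq_or_ne K 0 with rfl | hK
  · rw [h.mutualInfo_eq (Or.inl rfl)]
    simp
  have hK' : (0 : ℝ) < K := by positivity
  rcases eq_or_ne σc 0 with rfl | hc
  · rw [h.mutualInfo_eq_top hK]
    refine ENNReal.tendsto_ofReal_nhds_top.2 ?_
    refine Tendsto.const_mul_atTop (by norm_num) (Real.tendsto_log_atTop.comp ?_)
    refine tendsto_atTop_add_const_left _ _ ?_
    -- Squaring must stay to the right of zero, since the inverse tends to `+∞` only from that side.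
    have h0 : Tendsto (fun s : ℝ => s ^ 2) (𝓝[>] 0) (𝓝[>] 0) := by
      refine tendsto_nhdsWithin_iff.2 ⟨?_, ?_⟩
      · have : Tendsto (fun s : ℝ => s ^ 2) (𝓝 0) (𝓝 (0 ^ 2)) := (continuous_pow 2).tendsto 0
        rw [zero_pow two_ne_zero] at this
        exact this.mono_left nhdsWithin_le_nhds
      · filter_upwards [self_mem_nhdsWithin] with s hs
        exact pow_pos (Set.mem_Ioi.1 hs) 2
    have h1 := (tendsto_inv_nhdsGT_zero.comp h0).const_mul_atTop hK'
    simpa [div_eq_mul_inv, Function.comp_def] using h1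
  · rw [h.mutualInfo_eq (Or.inr (Or.inr hc))]
    have hc' : (0 : ℝ) < σc := by positivity
    have hcont : ContinuousAt (fun s : ℝ => ENNReal.ofReal
        (1 / 2 * Real.log (1 + (K : ℝ) / (s ^ 2 + (K : ℝ) * (σc : ℝ) ^ 2)))) 0 := by
      refine ENNReal.continuous_ofReal.continuousAt.comp ?_
      have h1 : (0 : ℝ) ^ 2 + (K : ℝ) * (σc : ℝ) ^ 2 ≠ 0 := by positivity
      have h2 : 1 + (K : ℝ) / ((0 : ℝ) ^ 2 + (K : ℝ) * (σc : ℝ) ^ 2) ≠ 0 := by positivity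
      fun_prop (disch := assumption)
    simpa using hcont.tendsto.mono_left nhdsWithin_le_nhds

end GaussianRedundancy

theorem mainTheorem3 {Ω : Type*} [MeasurableSpace Ω] (P : Measure Ω) [IsProbabilityMeasure P]
    (K : ℕ) (σu σc : ℝ≥0) (Y U : Ω → ℝ) (V : Fin K → Ω → ℝ)
    (h : GaussianRedundancy.IsModel P σu σc Y U V) :
    (0 < σu →
      GaussianRedundancy.mutualInfo P Y (GaussianRedundancy.observations Y U V) =
          ENNReal.ofReal
            (1 / 2 * Real.log (1 + (K : ℝ) / ((σu : ℝ) ^ 2 + (K : ℝ) * (σc : ℝ) ^ 2))) ∧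
      GaussianRedundancy.mutualInfo P Y (GaussianRedundancy.observations Y U V) =
          ENNReal.ofReal
            (1 / 2 * Real.log (1 + GaussianRedundancy.effWidth K σu σc /
              GaussianRedundancy.noiseVar σu σc))) ∧
    (σu = 0 →
      Tendsto
        (fun s : ℝ => ENNReal.ofReal
          (1 / 2 * Real.log (1 + (K : ℝ) / (s ^ 2 + (K : ℝ) * (σc : ℝ) ^ 2))))
        (𝓝[>] 0)
        (𝓝 (GaussianRedundancy.mutualInfo P Y (GaussianRedundancy.observations Y U V))) ∧
      Tendsto
        (fun s : ℝ => ENNReal.ofReal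
          (1 / 2 * Real.log (1 + GaussianRedundancy.effWidth K s σc /
            GaussianRedundancy.noiseVar s σc)))
        (𝓝[>] 0)
        (𝓝 (GaussianRedundancy.mutualInfo P Y (GaussianRedundancy.observations Y U V)))) := by
  refine ⟨fun hu => ?_, fun hu => ?_⟩
  · have hI := h.mutualInfo_eq (Or.inr (Or.inl hu.ne'))
    refine ⟨hI, ?_⟩
    rw [GaussianRedundancy.effWidth_div_noiseVar K (NNReal.coe_pos.2 hu)]
    exact hI
  · subst hu
    refine ⟨h.tendsto_mutualInfo, h.tendsto_mutualInfo.congr' ?_⟩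
    filter_upwards [self_mem_nhdsWithin] with s hs
    rw [GaussianRedundancy.effWidth_div_noiseVar K hs]
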